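/- Let $M\subset\mathbb{R}^2$ be a domain (a nonempty connected open set) with coordinates $(x^1,x^2)$, let $(x^1,x^2,y^1,y^2)$ be the induced coordinates on $TM$, and let $T_0M$ be $TM$ without the zero section. For an open set $U\subset M$ put $A_U=\{(x,y)\in TM : x\in U,\ y^1>0,\ y^2>0\}$. A conic pseudo-Finsler function on $A_U$ is a smooth function $F>0$ on $A_U$ with $F(x,\lambda y)=\lambda F(x,y)$ for $\lambda>0$ such that $dd_JF^2$ is a symplectic form on $A_U$, where $d_Jf=\frac{\partial f}{\partial y^i}\,dx^i$; it metrizes a spray $S$ on $A_U$ if $i_S\,dd_JF^2=-dF^2$ there. $S$ is called metrizable on $A_U$ if such an $F$ exists, and locally metrizable on $A_M$ if every point of $M$ has an open neighbourhood $U\subset M$ such that $S$ is metrizable on $A_U$. (1) Let $\varphi,\psi$ be smooth functions on $M$ and consider the affine spray $$S=y^1\frac{\partial}{\partial x^1}+y^2\frac{\partial}{\partial x^2}-\varphi(x)(y^1)^2\frac{\partial}{\partial y^1}-\psi(x)(y^2)^2\frac{\partial}{\partial y^2}.$$ It is a spray on $T_0M$, and its Ricci scalar, the trace of the Jacobi endomorphism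 $$R^i_j=2\frac{\partial G^i}{\partial x^j}-S(N^i_j)-N^i_kN^k_j,\qquad N^i_j=\frac{\partial G^i}{\partial y^j},\qquad 2G^1=\varphi (y^1)^2,\quad 2G^2=\psi (y^2)^2,$$ is $\rho=-y^1y^2(\varphi_{x^2}+\psi_{x^1})$. Assume that $\rho\neq0$ everywhere on $A_M$. Then $S$ is locally metrizable on $A_M$ by conic pseudo-Finsler functions if and only if there is a constant $c\in\mathbb{R}\setminus\{0,1\}$ such that $$c\,\varphi_{x^2}=(1-c)\,\psi_{x^1}\quad\text{on } M.$$ In particular this condition is necessary for $S$ to be metrizable on the whole of $A_M$ by one conic pseudo-Finsler function, and if $M$ is simply connected it is also sufficient for that. (2) Let $g$ be a smooth non-vanishing function on an open set $I\subset\mathbb{R}$ such that $x^1+x^2\in I$ for all $x\in M$, and let $\varphi(x)=\psi(x)=-2g'(x^1+x^2)/g(x^1+x^2)$. Then the condition above holds with $c=\tfrac12$, and $$F(x,y)=\frac{\sqrt{y^1y^2}}{|g(x^1+x^2)|}$$ (which is $\sqrt{y^1y^2}/g(x^1+x^2)$ when $g>0$) is a conic pseudo-Finsler function on $A_M$ that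 metrizes $S$. Moreover $F$ has scalar flag curvature $\kappa=4(g''g-(g')^2)(x^1+x^2)$; that is, on $A_M$, $$R^i_j=\kappa\Big(F^2\delta^i_j-F\frac{\partial F}{\partial y^j}y^i\Big).$$ -/

import Mathlib

open Set
open scoped ContDiff

namespace FinslerSpray

noncomputable section

/-! Everything lives on the tangent bundle `TM = M × V` of an open subset `M` of a finite-dimensional
real vector space `V`; a point of `TM` is a pair `(x, y)`, and a tangent vector to `TM` at such a
point is again a pair `(u, w)`, standing for `uⁱ ∂/∂xⁱ + wⁱ ∂/∂yⁱ`. -/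

variable {V : Type*} [NormedAddCommGroup V] [NormedSpace ℝ V]

/-- The tangent structure `J = ∂/∂yⁱ ⊗ dxⁱ`, that is `J (u, w) = (0, u)`. -/
def tangentJ (V : Type*) [NormedAddCommGroup V] [NormedSpace ℝ V] : (V × V) →L[ℝ] (V × V) :=
  (ContinuousLinearMap.inr ℝ V V).comp (ContinuousLinearMap.fst ℝ V V)

/-- The Liouville vector field `C = yⁱ ∂/∂yⁱ`. -/
def liouville (p : V × V) : V × V := (0, p.2)

/-- The slit tangent bundle `T₀M` of `M ⊆ V`. -/
def slitTangent (M : Set V) : Set (V × V) := {p | p.1 ∈ M ∧ p.2 ≠ 0}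

/-- `S` is a spray on `M`: a vector field, smooth on `T₀M`, with `J S = C` and `[C, S] = S`. -/
structure IsSpray (M : Set V) (S : V × V → V × V) : Prop where
  smooth : ContDiffOn ℝ ∞ S (slitTangent M)
  tangentJ_eq : ∀ p ∈ slitTangent M, tangentJ V (S p) = liouville p
  lieBracket_eq : ∀ p ∈ slitTangent M, VectorField.lieBracket ℝ liouville S p = S p

/-- The coefficients `Gⁱ` of a spray `S = yⁱ ∂/∂xⁱ - 2 Gⁱ ∂/∂yⁱ`. -/
def sprayCoeff (S : V × V → V × V) (p : V × V) : V := -(1 / 2 : ℝ) • (S p).2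

/-- The nonlinear connection `Nⁱⱼ = ∂Gⁱ/∂yʲ`, as an endomorphism of `V` at each `(x, y)`. -/
def nonlinearConnection (S : V × V → V × V) (p : V × V) : V →L[ℝ] V :=
  fderiv ℝ (fun y => sprayCoeff S (p.1, y)) p.2

/-- The components `Rⁱⱼ = 2 ∂Gⁱ/∂xʲ - S(Nⁱⱼ) - Nⁱₖ Nᵏⱼ` of the Jacobi endomorphism
`Φ = Rⁱⱼ ∂/∂yⁱ ⊗ dxʲ`, as an endomorphism of `V` at each `(x, y)`. -/
def jacobiEndomorphism (S : V × V → V × V) (p : V × V) : V →L[ℝ] V :=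
  (2 : ℝ) • fderiv ℝ (fun x => sprayCoeff S (x, p.2)) p.1
    - fderiv ℝ (nonlinearConnection S) p (S p)
    - (nonlinearConnection S p).comp (nonlinearConnection S p)

/-- The Ricci scalar `ρ`, given by `(n - 1) ρ = Tr Φ` in dimension `n`. -/
def ricciScalar (S : V × V → V × V) (p : V × V) : ℝ :=
  LinearMap.trace ℝ V (jacobiEndomorphism S p : V →ₗ[ℝ] V) / ((Module.finrank ℝ V : ℝ) - 1)

/-- The 1-form `d_J f = (∂f/∂yⁱ) dxⁱ`, that is `d_J f (ξ) = df (J ξ)`. -/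
def dJ (f : V × V → ℝ) (p : V × V) : (V × V) [⋀^Fin 1]→L[ℝ] ℝ :=
  ContinuousAlternatingMap.ofSubsingleton ℝ (V × V) ℝ (0 : Fin 1)
    ((fderiv ℝ f p).comp (tangentJ V))

/-- A 2-form is symplectic on the open set `A`: smooth, closed and nondegenerate there. -/
structure IsSymplecticOn (Ω : V × V → (V × V) [⋀^Fin 2]→L[ℝ] ℝ) (A : Set (V × V)) : Prop where
  smooth : ContDiffOn ℝ ∞ Ω A
  closed : ∀ p ∈ A, extDeriv Ω p = 0
  nondegenerate : ∀ p ∈ A, ∀ ξ : V × V, (∀ η : V × V, Ω p ![ξ, η] = 0) → ξ = 0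

/-- A positive conical region of the slit tangent bundle: an open set of nonzero tangent vectors
that is stable under multiplication of the vectors by positive numbers. -/
structure IsConicRegion (A : Set (V × V)) : Prop where
  isOpen : IsOpen A
  ne_zero : ∀ p ∈ A, p.2 ≠ 0
  smul_mem : ∀ p ∈ A, ∀ t : ℝ, 0 < t → (p.1, t • p.2) ∈ A

/-- `F` is a conic pseudo-Finsler function on the conical region `A`: it is smooth, strictly positive
and positively 1-homogeneous in `y` on `A`, and `d d_J F²` is symplectic on `A`. -/
structure IsConicPseudoFinsler (A : Set (V × V)) (F : V × V → ℝ) : Prop where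
  region : IsConicRegion A
  smooth : ContDiffOn ℝ ∞ F A
  pos : ∀ p ∈ A, 0 < F p
  homogeneous : ∀ p ∈ A, ∀ t : ℝ, 0 < t → F (p.1, t • p.2) = t * F p
  symplectic : IsSymplecticOn (extDeriv (dJ fun p => F p ^ 2)) A

/-- `S` is the geodesic spray of `F` on `A`: `i_S d d_J F² = - d F²`. -/
def IsGeodesicSpray (A : Set (V × V)) (S : V × V → V × V) (F : V × V → ℝ) : Prop :=
  ∀ p ∈ A, ∀ ξ : V × V,
    extDeriv (dJ fun q => F q ^ 2) p ![S p, ξ] = -(fderiv ℝ (fun q => F q ^ 2) p ξ)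

/-- `S` is metrizable on `A` by a conic pseudo-Finsler function. -/
def IsConicMetrizable (A : Set (V × V)) (S : V × V → V × V) : Prop :=
  ∃ F : V × V → ℝ, IsConicPseudoFinsler A F ∧ IsGeodesicSpray A S F

/-- `F`, with geodesic spray `S`, has scalar flag curvature `κ` on `A`:
`Φ = κ (F² J - F d_J F ⊗ C)`. -/
def HasScalarFlagCurvature (A : Set (V × V)) (S : V × V → V × V) (F κ : V × V → ℝ) : Prop :=
  ContDiffOn ℝ ∞ κ A ∧ ∀ p ∈ A, ∀ u : V,
    jacobiEndomorphism S p u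
      = κ p • (F p ^ 2 • u - (F p * fderiv ℝ F p (tangentJ V (u, 0))) • p.2)

/-! In the plane, the coordinates `x¹, x², y¹, y²` are `x 0, x 1, y 0, y 1`. -/

/-- The partial derivative `∂f/∂xʲ` of a function on the plane. -/
def partialDeriv (j : Fin 2) (f : (Fin 2 → ℝ) → ℝ) (x : Fin 2 → ℝ) : ℝ :=
  fderiv ℝ f x (Pi.single j 1)

/-- The affine spray `y¹ ∂/∂x¹ + y² ∂/∂x² - φ(x) (y¹)² ∂/∂y¹ - ψ(x) (y²)² ∂/∂y²`. -/
def affineSpray (φ ψ : (Fin 2 → ℝ) → ℝ) (p : (Fin 2 → ℝ) × (Fin 2 → ℝ)) :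
    (Fin 2 → ℝ) × (Fin 2 → ℝ) :=
  (p.2, ![-(φ p.1 * p.2 0 ^ 2), -(ψ p.1 * p.2 1 ^ 2)])

/-- The conical region `{(x, y) | x ∈ M, y¹ > 0, y² > 0}` of `TM`. -/
def positiveCone (M : Set (Fin 2 → ℝ)) : Set ((Fin 2 → ℝ) × (Fin 2 → ℝ)) :=
  {p | p.1 ∈ M ∧ 0 < p.2 0 ∧ 0 < p.2 1}

end

end FinslerSpray

open FinslerSpray

/-!
Coordinates are numbered from `0` below: `x⁰, x¹, y⁰, y¹` are `x 0, x 1, y 0, y 1`.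

For `S = affineSpray φ ψ` the nonlinear connection is diagonal, with entries `φ y⁰` and `ψ y¹`; its
horizontal lifts are `H₀ = ∂/∂x⁰ - φ y⁰ ∂/∂y⁰` and `H₁ = ∂/∂x¹ - ψ y¹ ∂/∂y¹`.

**Necessity.** Let `E = F²` be the energy of a metric with geodesic spray `S`. Differentiating the
conservation law `S E = 0` along the fibres, and using the Euler-Lagrange equations and the
homogeneity of `E`, gives `H₀ E = H₁ E = 0` (`fderiv_horizontalLift_eq_zero`). Hence the bracket
`[H₀, H₁] = (∂φ/∂x¹) y⁰ ∂/∂y⁰ - (∂ψ/∂x⁰) y¹ ∂/∂y¹` also annihilates `E`. Combined with Euler's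
relation, and with the fact that `ρ ≠ 0` means `∂φ/∂x¹ + ∂ψ/∂x⁰ ≠ 0`, this gives
`y⁰ ∂E/∂y⁰ = 2 a E` and `y¹ ∂E/∂y¹ = 2 (1 - a) E`, where
`a = (∂ψ/∂x⁰) / (∂φ/∂x¹ + ∂ψ/∂x⁰)` depends on `x` only. Since `y⁰ ∂/∂y⁰` commutes with `H₀` and
`H₁`, the function `a` is horizontally constant, so its differential vanishes
(`fibreExponent_of_isGeodesicSpray`). It does not involve the metric, so it is one constant `c` on
the connected set `M`. The values `0` and `1` are excluded because `E` would then not depend on one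
of the fibre coordinates, and `d d_J E` would be degenerate.

**Sufficiency.** If `c` satisfies the condition, the `1`-form `c φ dx⁰ + (1 - c) ψ dx¹` is closed,
and a primitive `θ` of it gives the metric `F = exp θ · (y⁰)ᶜ (y¹)¹⁻ᶜ`, which is nondegenerate for
`c ≠ 0, 1` (`isConicPseudoFinsler_metric`, `isGeodesicSpray_metric`). Primitives exist on balls by
the Poincaré lemma for convex sets, and on a simply connected `M` because the local primitives,
which are unique up to locally constant functions, are the sheets of a covering of `M`
(`IsSimplyConnected.exists_forall_hasFDerivAt_of_fderiv_symmetric`).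

The explicit metric is the case `c = 1 / 2`, `θ = -log |g|`, and its flag curvature is read off the
Jacobi endomorphism of the affine spray (`jacobiEndomorphism_affineSpray`).
-/

/-! ### Closed `1`-forms on simply connected open sets -/

open Filter Topology in
/-- On a simply connected, locally path connected space, functions `f i` given on the members `U i`
of an open cover, whose differences are locally constant, come from one global function: the
locally constant transition functions `f i - f j` glue the sets `U i × G`, with `G` discrete, to a
covering space, and a simply connected space lifts to any covering of itself. -/
theorem exists_sub_locally_constant_of_simplyConnectedSpace {X G : Type*} [TopologicalSpace X]
    [SimplyConnectedSpace X] [LocallyPathConnectedSpace X] [AddCommGroup G]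
    (U : X → Set X) (hU : ∀ i, IsOpen (U i)) (hmem : ∀ x, x ∈ U x) (f : X → X → G)
    (hf : ∀ i j, ∀ x ∈ U i ∩ U j, ∀ᶠ y in 𝓝 x, f i y - f j y = f i x - f j x) :
    ∃ g : X → G, ∀ i, ∀ x ∈ U i, ∀ᶠ y in 𝓝 x, g y - f i y = g x - f i x := by
  let : TopologicalSpace G := ⊥
  have : DiscreteTopology G := ⟨rfl⟩
  -- the element `v` over `x` in the chart `i` stands for the germ of `f i + v` at `x`
  let Z : FiberBundleCore X X G :=
    { baseSet := U
      isOpen_baseSet := hU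
      indexAt := id
      mem_baseSet_at := hmem
      coordChange := fun i j x v => v + (f i x - f j x)
      coordChange_self := by simp
      continuousOn_coordChange := by
        rintro i j ⟨x, v⟩ ⟨hx, -⟩
        refine ContinuousAt.continuousWithinAt (ContinuousAt.congr
          (f := fun p : X × G => p.2 + (f i x - f j x)) ?_ ?_)
        · exact (continuous_of_discreteTopology
            (f := fun v : G => v + (f i x - f j x))).continuousAt.comp continuousAt_snd
        · rw [nhds_prod_eq]
          filter_upwards [(hf i j x hx).prod_inl (𝓝 v)] with p hp
          rw [hp]
      coordChange_comp := by
        intro i j k x _ v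
        abel }
  have cov : IsCoveringMap (Bundle.TotalSpace.proj : Bundle.TotalSpace G Z.Fiber → X) :=
    FiberBundle.isCoveringMap
  obtain ⟨a⟩ : Nonempty X := inferInstance
  obtain ⟨σ, ⟨-, hσ⟩, -⟩ := cov.existsUnique_continuousMap_lifts (ContinuousMap.id X) a
    (⟨a, (0 : G)⟩ : Bundle.TotalSpace G Z.Fiber) rfl
  -- the fibre coordinate of `σ x` in the chart `i` is locally constant, and equals `g x - f i x`
  have hσ' : ∀ x, (σ x).proj = x := fun x => congr_fun hσ x
  let v : X → G := fun x => (σ x).snd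
  refine ⟨fun x => v x + f (σ x).proj x, fun i x hx => ?_⟩
  have hc : ContinuousAt (fun y => (Z.localTriv i (σ y)).2) x := by
    refine continuousAt_snd.comp (ContinuousAt.comp (f := σ) ?_ σ.continuous.continuousAt)
    refine (Z.localTriv i).continuousOn.continuousAt
      ((Z.localTriv i).open_source.mem_nhds ?_)
    rw [Z.mem_localTriv_source]
    change (σ x).proj ∈ U i
    rwa [hσ']
  have hloc : ∀ᶠ y in 𝓝 x, (Z.localTriv i (σ y)).2 = (Z.localTriv i (σ x)).2 := by
    have := hc.eventually_mem ((isOpen_discrete {(Z.localTriv i (σ x)).2}).mem_nhds rfl)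
    exact this
  have hval : ∀ y, (Z.localTriv i (σ y)).2 = v y + f (σ y).proj y - f i y := by
    intro y
    have : (Z.localTriv i (σ y)).2 = v y + (f (σ y).proj (σ y).proj - f i (σ y).proj) := rfl
    rw [this]
    simp only [hσ']
    abel
  filter_upwards [hloc] with y hy
  rw [← hval, ← hval, hy]

/-- The Poincaré lemma for `1`-forms on a simply connected open set: a closed `1`-form is exact. -/
theorem IsSimplyConnected.exists_forall_hasFDerivAt_of_fderiv_symmetric {E : Type*}
    [NormedAddCommGroup E] [NormedSpace ℝ E] {s : Set E} (hs : IsSimplyConnected s)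
    (hso : IsOpen s) {η : E → E →L[ℝ] ℝ} (hη : DifferentiableOn ℝ η s)
    (hdη : ∀ a ∈ s, ∀ x y, fderiv ℝ η a x y = fderiv ℝ η a y x) :
    ∃ f : E → ℝ, ∀ a ∈ s, HasFDerivAt f (η a) a := by
  classical
  have := hs.simplyConnectedSpace
  have := hso.locallyPathConnectedSpace
  have hball : ∀ i : s, ∃ U : Set E, IsOpen U ∧ (i : E) ∈ U ∧ ∃ f : E → ℝ, ∀ a ∈ U,
      HasFDerivAt f (η a) a := by
    rintro ⟨i, hi⟩
    obtain ⟨r, hr, hrs⟩ := Metric.isOpen_iff.1 hso i hi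
    exact ⟨Metric.ball i r, Metric.isOpen_ball, Metric.mem_ball_self hr,
      (convex_ball i r).exists_forall_hasFDerivAt_of_fderiv_symmetric Metric.isOpen_ball
        (hη.mono hrs) fun a ha => hdη a (hrs ha)⟩
  choose U hUo hUmem f hf using hball
  obtain ⟨g, hg⟩ := exists_sub_locally_constant_of_simplyConnectedSpace
    (fun i : s => Subtype.val ⁻¹' U i) (fun i => (hUo i).preimage continuous_subtype_val) hUmem
    (fun i x => f i x) (by
      rintro i j x ⟨hxi, hxj⟩
      have key := ((hUo i).inter (hUo j)).isOpen_inter_preimage_of_fderiv_eq_zero (𝕜 := ℝ)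
        (f := fun y => f i y - f j y)
        (fun y hy => ((hf i y hy.1).sub (hf j y hy.2)).differentiableAt.differentiableWithinAt)
        (fun y hy => by
          simpa using ((hf i y hy.1).fun_sub (hf j y hy.2)).fderiv) {f i x - f j x}
      filter_upwards [(key.preimage continuous_subtype_val).mem_nhds ⟨⟨hxi, hxj⟩, rfl⟩] with y hy
      exact hy.2)
  refine ⟨fun x => if h : x ∈ s then g ⟨x, h⟩ else 0, fun a ha => ?_⟩
  have hga := hg ⟨a, ha⟩ ⟨a, ha⟩ (hUmem ⟨a, ha⟩)
  rw [nhds_subtype_eq_comap, Filter.eventually_comap] at hga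
  refine ((hf ⟨a, ha⟩ a (hUmem ⟨a, ha⟩)).add_const
    (g ⟨a, ha⟩ - f ⟨a, ha⟩ a)).congr_of_eventuallyEq ?_
  filter_upwards [hga, hso.mem_nhds ha] with y hy hys
  have := hy ⟨y, hys⟩ rfl
  simp only [hys, dite_true]
  linarith

namespace FinslerSpray

/-! ### The form `d d_J f` and homogeneous functions -/

section General

lemma minSmoothness_two_le_infty : minSmoothness ℝ 2 ≤ ∞ := by
  rw [minSmoothness_of_isRCLikeNormedField]
  exact WithTop.coe_le_coe.2 (le_top : (2 : ℕ∞) ≤ ⊤)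

variable {V : Type*} [NormedAddCommGroup V] [NormedSpace ℝ V]

@[simp] lemma tangentJ_apply (p : V × V) : tangentJ V p = (0, p.1) := rfl

lemma dJ_apply (f : V × V → ℝ) (p : V × V) (v : Fin 1 → V × V) :
    dJ f p v = fderiv ℝ f p (0, (v 0).1) := rfl

lemma contDiffAt_dJ {f : V × V → ℝ} {p : V × V} (hf : ContDiffAt ℝ ∞ f p) :
    ContDiffAt ℝ ∞ (dJ f) p := by
  have h : ContDiffAt ℝ ∞ (fderiv ℝ f) p := hf.fderiv_right (by simp)
  exact (ContinuousAlternatingMap.ofSubsingletonLIE (𝕜 := ℝ) (E := V × V) (F := ℝ)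
    (0 : Fin 1)).toContinuousLinearEquiv.contDiff.contDiffAt.comp p
    (h.clm_comp contDiffAt_const)

lemma contDiffAt_extDeriv_dJ {f : V × V → ℝ} {p : V × V} (hf : ContDiffAt ℝ ∞ f p) :
    ContDiffAt ℝ ∞ (extDeriv (dJ f)) p := by
  have h : ContDiffAt ℝ ∞ (fderiv ℝ (dJ f)) p := (contDiffAt_dJ hf).fderiv_right (by simp)
  exact (ContinuousAlternatingMap.alternatizeUncurryFinCLM ℝ (V × V) ℝ
    (n := 1)).contDiff.contDiffAt.comp p h

/-- `d d_J f (u, v)` is expressed by the derivatives of the vertical derivatives of `f`. -/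
lemma extDeriv_dJ_apply {f : V × V → ℝ} {p : V × V} (hf : ContDiffAt ℝ ∞ f p) (u v : V × V) :
    extDeriv (dJ f) p ![u, v]
      = fderiv ℝ (fun q => fderiv ℝ f q (0, v.1)) p u
        - fderiv ℝ (fun q => fderiv ℝ f q (0, u.1)) p v := by
  rw [extDeriv_apply ((contDiffAt_dJ hf).differentiableAt (by simp))]
  simp [Fin.sum_univ_two, dJ_apply, Fin.removeNth, sub_eq_add_neg]

lemma fderiv_fderiv_apply_const {f : V × V → ℝ} {p : V × V} (hf : ContDiffAt ℝ ∞ f p)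
    (u v : V × V) :
    fderiv ℝ (fun q => fderiv ℝ f q v) p u = fderiv ℝ (fderiv ℝ f) p u v := by
  have h : ContDiffAt ℝ ∞ (fderiv ℝ f) p := hf.fderiv_right (by simp)
  rw [fderiv_clm_apply (h.differentiableAt (by simp)) (by fun_prop)]
  simp

lemma fderiv_fderiv_apply {f : V × V → ℝ} {p : V × V} (hf : ContDiffAt ℝ ∞ f p)
    {W : V × V → V × V} (hW : DifferentiableAt ℝ W p) (u : V × V) :
    fderiv ℝ (fun q => fderiv ℝ f q (W q)) p u
      = fderiv ℝ (fderiv ℝ f) p u (W p) + fderiv ℝ f p (fderiv ℝ W p u) := by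
  have h : ContDiffAt ℝ ∞ (fderiv ℝ f) p := hf.fderiv_right (by simp)
  rw [fderiv_clm_apply (h.differentiableAt (by simp)) hW]
  simp [add_comm]

lemma hasFDerivAt_liouville (p : V × V) :
    HasFDerivAt liouville
      ((0 : V × V →L[ℝ] V).prod (ContinuousLinearMap.snd ℝ V V)) p :=
  ((0 : V × V →L[ℝ] V).prod (ContinuousLinearMap.snd ℝ V V)).hasFDerivAt

/-- Euler's theorem for a function that is positively `2`-homogeneous in the fibre. -/
lemma fderiv_liouville_of_homogeneous {A : Set (V × V)} {E : V × V → ℝ}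
    (hE : ∀ p ∈ A, ∀ t : ℝ, 0 < t → E (p.1, t • p.2) = t ^ 2 * E p) {p : V × V} (hp : p ∈ A)
    (hd : DifferentiableAt ℝ E p) : fderiv ℝ E p (liouville p) = 2 * E p := by
  have hc : HasDerivAt (fun t : ℝ => ((p.1, t • p.2) : V × V)) (0, p.2) 1 := by
    have := ((hasDerivAt_id (1 : ℝ)).smul_const p.2)
    simpa using (hasDerivAt_const (1 : ℝ) p.1).prodMk this
  have hp1 : ((p.1, (1 : ℝ) • p.2) : V × V) = p := by simp
  have h1 : HasDerivAt (fun t : ℝ => E (p.1, t • p.2)) (fderiv ℝ E p (0, p.2)) 1 := by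
    refine HasFDerivAt.comp_hasDerivAt (1 : ℝ) ?_ hc
    rw [hp1]
    exact hd.hasFDerivAt
  have h2 : HasDerivAt (fun t : ℝ => t ^ 2 * E p) (2 * E p) 1 := by
    simpa using ((hasDerivAt_pow 2 (1 : ℝ)).mul_const (E p))
  refine h1.unique (h2.congr_of_eventuallyEq ?_)
  filter_upwards [lt_mem_nhds (zero_lt_one' ℝ)] with t ht
  exact hE p hp t ht

end General

/-! ### The affine sprays -/

lemma hasFDerivAt_pair {E : Type*} [NormedAddCommGroup E] [NormedSpace ℝ E] {f g : E → ℝ}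
    {f' g' : E →L[ℝ] ℝ} {x : E} (hf : HasFDerivAt f f' x) (hg : HasFDerivAt g g' x) :
    HasFDerivAt (fun x => ![f x, g x]) (ContinuousLinearMap.pi ![f', g']) x := by
  rw [hasFDerivAt_pi]
  intro i
  fin_cases i
  · exact hf
  · exact hg

lemma hasFDerivAt_fibre_coord (i : Fin 2) (p : (Fin 2 → ℝ) × (Fin 2 → ℝ)) :
    HasFDerivAt (fun q : (Fin 2 → ℝ) × (Fin 2 → ℝ) => q.2 i)
      ((ContinuousLinearMap.proj (R := ℝ) (φ := fun _ : Fin 2 => ℝ) i).comp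
        (ContinuousLinearMap.snd ℝ _ _)) p :=
  ((ContinuousLinearMap.proj (R := ℝ) (φ := fun _ : Fin 2 => ℝ) i).comp
    (ContinuousLinearMap.snd ℝ (Fin 2 → ℝ) (Fin 2 → ℝ))).hasFDerivAt

lemma hasFDerivAt_comp_fst {f : (Fin 2 → ℝ) → ℝ} {f' : (Fin 2 → ℝ) →L[ℝ] ℝ}
    {p : (Fin 2 → ℝ) × (Fin 2 → ℝ)} (hf : HasFDerivAt f f' p.1) :
    HasFDerivAt (fun q : (Fin 2 → ℝ) × (Fin 2 → ℝ) => f q.1)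
      (f'.comp (ContinuousLinearMap.fst ℝ _ _)) p :=
  hf.comp p hasFDerivAt_fst

lemma fderiv_apply_eq_partialDeriv (f : (Fin 2 → ℝ) → ℝ) (x u : Fin 2 → ℝ) :
    fderiv ℝ f x u = partialDeriv 0 f x * u 0 + partialDeriv 1 f x * u 1 := by
  have hu : u = u 0 • Pi.single 0 1 + u 1 • Pi.single 1 1 := by
    ext i; fin_cases i <;> simp
  conv_lhs => rw [hu]
  simp only [map_add, map_smul, smul_eq_mul, partialDeriv]
  ring

section Affine

variable {φ ψ : (Fin 2 → ℝ) → ℝ}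

lemma contDiffOn_affineSpray {M : Set (Fin 2 → ℝ)} (hφ : ContDiffOn ℝ ∞ φ M)
    (hψ : ContDiffOn ℝ ∞ ψ M) : ContDiffOn ℝ ∞ (affineSpray φ ψ) (Prod.fst ⁻¹' M) := by
  have hx : ContDiffOn ℝ ∞ (Prod.fst : (Fin 2 → ℝ) × (Fin 2 → ℝ) → _) (Prod.fst ⁻¹' M) :=
    contDiffOn_fst
  have hφ' := hφ.comp hx fun p hp => hp
  have hψ' := hψ.comp hx fun p hp => hp
  have hy : ∀ i : Fin 2, ContDiffOn ℝ ∞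
      (fun p : (Fin 2 → ℝ) × (Fin 2 → ℝ) => p.2 i) (Prod.fst ⁻¹' M) := fun i => by fun_prop
  refine contDiffOn_snd.prodMk ?_
  rw [contDiffOn_pi]
  intro i
  fin_cases i
  · exact (hφ'.mul ((hy 0).pow 2)).neg
  · exact (hψ'.mul ((hy 1).pow 2)).neg

lemma fderiv_affineSpray {p : (Fin 2 → ℝ) × (Fin 2 → ℝ)} (hφ : DifferentiableAt ℝ φ p.1)
    (hψ : DifferentiableAt ℝ ψ p.1) (v : (Fin 2 → ℝ) × (Fin 2 → ℝ)) :
    fderiv ℝ (affineSpray φ ψ) p v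
      = (v.2, ![-(fderiv ℝ φ p.1 v.1 * p.2 0 ^ 2 + 2 * φ p.1 * p.2 0 * v.2 0),
          -(fderiv ℝ ψ p.1 v.1 * p.2 1 ^ 2 + 2 * ψ p.1 * p.2 1 * v.2 1)]) := by
  have h1 := ((hasFDerivAt_comp_fst hφ.hasFDerivAt).mul ((hasFDerivAt_fibre_coord 0 p).pow 2)).neg
  have h2 := ((hasFDerivAt_comp_fst hψ.hasFDerivAt).mul ((hasFDerivAt_fibre_coord 1 p).pow 2)).neg
  have h := (hasFDerivAt_snd (𝕜 := ℝ) (E := Fin 2 → ℝ) (F := Fin 2 → ℝ) (p := p)).prodMk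
    (hasFDerivAt_pair h1 h2)
  have h' := h.fderiv
  change fderiv ℝ (affineSpray φ ψ) p = _ at h'
  rw [h']
  ext i
  · simp
  · fin_cases i <;> simp <;> ring

lemma isSpray_affineSpray {M : Set (Fin 2 → ℝ)} (hM : IsOpen M) (hφ : ContDiffOn ℝ ∞ φ M)
    (hψ : ContDiffOn ℝ ∞ ψ M) : IsSpray M (affineSpray φ ψ) where
  smooth := (contDiffOn_affineSpray hφ hψ).mono fun _ hp => hp.1
  tangentJ_eq _ _ := rfl
  lieBracket_eq := by
    rintro p ⟨hp, -⟩
    have hφ' := (hφ.contDiffAt (hM.mem_nhds hp)).differentiableAt (by simp)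
    have hψ' := (hψ.contDiffAt (hM.mem_nhds hp)).differentiableAt (by simp)
    rw [VectorField.lieBracket, fderiv_affineSpray hφ' hψ', (hasFDerivAt_liouville p).fderiv]
    ext i
    · simp [affineSpray, liouville]
    · fin_cases i <;> simp [affineSpray, liouville] <;> ring

lemma nonlinearConnection_affineSpray (p : (Fin 2 → ℝ) × (Fin 2 → ℝ)) :
    nonlinearConnection (affineSpray φ ψ) p = ContinuousLinearMap.pi
      ![(φ p.1 * p.2 0) • ContinuousLinearMap.proj 0,
        (ψ p.1 * p.2 1) • ContinuousLinearMap.proj 1] := by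
  have hy : ∀ i : Fin 2, HasFDerivAt (fun y : Fin 2 → ℝ => y i)
      (ContinuousLinearMap.proj (R := ℝ) (φ := fun _ : Fin 2 => ℝ) i) p.2 := fun i =>
    hasFDerivAt_apply i p.2
  have h := (hasFDerivAt_pair (((hy 0).pow 2).const_mul (φ p.1)).neg
    (((hy 1).pow 2).const_mul (ψ p.1)).neg).const_smul (-(1 / 2 : ℝ))
  refine h.fderiv.trans ?_
  ext v i
  fin_cases i <;> simp <;> ring

/-- Only the first derivatives `∂φ/∂x¹` and `∂ψ/∂x⁰` survive in the Jacobi endomorphism: the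
quadratic terms in `φ` and `ψ` cancel between `S(N)` and `N ∘ N`. -/
lemma jacobiEndomorphism_affineSpray {p : (Fin 2 → ℝ) × (Fin 2 → ℝ)}
    (hφ : DifferentiableAt ℝ φ p.1) (hψ : DifferentiableAt ℝ ψ p.1) (u : Fin 2 → ℝ) :
    jacobiEndomorphism (affineSpray φ ψ) p u
      = ![partialDeriv 1 φ p.1 * p.2 0 * (p.2 0 * u 1 - p.2 1 * u 0),
          partialDeriv 0 ψ p.1 * p.2 1 * (p.2 1 * u 0 - p.2 0 * u 1)] := by
  have hG := ((hasFDerivAt_pair (hφ.hasFDerivAt.mul_const (p.2 0 ^ 2)).neg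
    (hψ.hasFDerivAt.mul_const (p.2 1 ^ 2)).neg).const_smul (-(1 / 2 : ℝ))).fderiv
  change fderiv ℝ (fun x => sprayCoeff (affineSpray φ ψ) (x, p.2)) p.1 = _ at hG
  have h1 := (hasFDerivAt_comp_fst hφ.hasFDerivAt).mul (hasFDerivAt_fibre_coord 0 p)
  have h2 := (hasFDerivAt_comp_fst hψ.hasFDerivAt).mul (hasFDerivAt_fibre_coord 1 p)
  -- the nonlinear connection is a fixed linear function of its two diagonal entries
  let D : Fin 2 → ((Fin 2 → ℝ) →L[ℝ] (Fin 2 → ℝ)) :=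
    fun i => ContinuousLinearMap.single ℝ (fun _ : Fin 2 => ℝ) i ∘L
      ContinuousLinearMap.proj (R := ℝ) (φ := fun _ : Fin 2 => ℝ) i
  have hN : HasFDerivAt (nonlinearConnection (affineSpray φ ψ)) _ p :=
    ((h1.smul_const (D 0)).add (h2.smul_const (D 1))).congr_of_eventuallyEq
      (Filter.Eventually.of_forall fun q => by
        rw [nonlinearConnection_affineSpray]
        ext v i
        fin_cases i <;> simp [D])
  rw [jacobiEndomorphism, hG, hN.fderiv, nonlinearConnection_affineSpray]
  ext i
  fin_cases i <;>
    simp [D, affineSpray, fderiv_apply_eq_partialDeriv] <;> ring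

lemma ricciScalar_affineSpray {p : (Fin 2 → ℝ) × (Fin 2 → ℝ)}
    (hφ : DifferentiableAt ℝ φ p.1) (hψ : DifferentiableAt ℝ ψ p.1) :
    ricciScalar (affineSpray φ ψ) p
      = -(p.2 0 * p.2 1 * (partialDeriv 1 φ p.1 + partialDeriv 0 ψ p.1)) := by
  rw [ricciScalar, LinearMap.trace_eq_matrix_trace ℝ (Pi.basisFun ℝ (Fin 2)), Matrix.trace]
  simp only [Matrix.diag_apply, LinearMap.toMatrix_apply, Fin.sum_univ_two,
    ContinuousLinearMap.coe_coe, jacobiEndomorphism_affineSpray hφ hψ]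
  simp
  norm_num
  ring

end Affine

/-! ### The positive cone -/

lemma isOpen_positiveCone {U : Set (Fin 2 → ℝ)} (hU : IsOpen U) : IsOpen (positiveCone U) := by
  refine (hU.preimage continuous_fst).inter (IsOpen.inter ?_ ?_)
  · exact isOpen_lt continuous_const ((continuous_apply 0).comp continuous_snd)
  · exact isOpen_lt continuous_const ((continuous_apply 1).comp continuous_snd)

lemma isConicRegion_positiveCone {U : Set (Fin 2 → ℝ)} (hU : IsOpen U) :
    IsConicRegion (positiveCone U) where
  isOpen := isOpen_positiveCone hU
  ne_zero p hp h := by simpa [h] using hp.2.1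
  smul_mem p hp t ht := ⟨hp.1, by simpa using mul_pos ht hp.2.1, by simpa using mul_pos ht hp.2.2⟩

/-! ### Necessity: horizontal and vertical derivatives of the energy -/

section Necessity

/-- The horizontal lift of the constant vector field `w` with respect to the nonlinear connection
of the affine spray. -/
def horizontalLift (φ ψ : (Fin 2 → ℝ) → ℝ) (w : Fin 2 → ℝ) (p : (Fin 2 → ℝ) × (Fin 2 → ℝ)) :
    (Fin 2 → ℝ) × (Fin 2 → ℝ) :=
  (w, ![-(φ p.1 * p.2 0 * w 0), -(ψ p.1 * p.2 1 * w 1)])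

/-- The vertical vector field `s₀ y⁰ ∂/∂y⁰ + s₁ y¹ ∂/∂y¹`. -/
def scaledLiouville (s : Fin 2 → ℝ) (p : (Fin 2 → ℝ) × (Fin 2 → ℝ)) :
    (Fin 2 → ℝ) × (Fin 2 → ℝ) :=
  (0, ![s 0 * p.2 0, s 1 * p.2 1])

variable {φ ψ : (Fin 2 → ℝ) → ℝ} {p : (Fin 2 → ℝ) × (Fin 2 → ℝ)}

lemma differentiableAt_horizontalLift (hφ : DifferentiableAt ℝ φ p.1)
    (hψ : DifferentiableAt ℝ ψ p.1) (w : Fin 2 → ℝ) :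
    DifferentiableAt ℝ (horizontalLift φ ψ w) p ∧ ∀ v, fderiv ℝ (horizontalLift φ ψ w) p v
      = (0, ![-((fderiv ℝ φ p.1 v.1 * p.2 0 + φ p.1 * v.2 0) * w 0),
          -((fderiv ℝ ψ p.1 v.1 * p.2 1 + ψ p.1 * v.2 1) * w 1)]) := by
  have h1 := (((hasFDerivAt_comp_fst hφ.hasFDerivAt).mul
    (hasFDerivAt_fibre_coord 0 p)).mul_const (w 0)).neg
  have h2 := (((hasFDerivAt_comp_fst hψ.hasFDerivAt).mul
    (hasFDerivAt_fibre_coord 1 p)).mul_const (w 1)).neg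
  have h : HasFDerivAt (horizontalLift φ ψ w) _ p :=
    (hasFDerivAt_const w p).prodMk (hasFDerivAt_pair h1 h2)
  refine ⟨h.differentiableAt, fun v => ?_⟩
  rw [h.fderiv]
  ext i
  · simp
  · fin_cases i <;> simp <;> ring

lemma differentiableAt_scaledLiouville (s : Fin 2 → ℝ) :
    DifferentiableAt ℝ (scaledLiouville s) p ∧
      ∀ v, fderiv ℝ (scaledLiouville s) p v = scaledLiouville s v := by
  have h : HasFDerivAt (scaledLiouville s) _ p :=
    (hasFDerivAt_const (0 : Fin 2 → ℝ) p).prodMk (hasFDerivAt_pair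
      ((hasFDerivAt_fibre_coord 0 p).const_mul (s 0))
      ((hasFDerivAt_fibre_coord 1 p).const_mul (s 1)))
  refine ⟨h.differentiableAt, fun v => ?_⟩
  rw [h.fderiv]
  ext i
  · simp [scaledLiouville]
  · fin_cases i <;> simp [scaledLiouville]

lemma lieBracket_scaledLiouville_horizontalLift (hφ : DifferentiableAt ℝ φ p.1)
    (hψ : DifferentiableAt ℝ ψ p.1) (s w : Fin 2 → ℝ) :
    VectorField.lieBracket ℝ (scaledLiouville s) (horizontalLift φ ψ w) p = 0 := by
  rw [VectorField.lieBracket, (differentiableAt_horizontalLift hφ hψ w).2,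
    (differentiableAt_scaledLiouville s).2]
  ext i
  · simp [scaledLiouville]
  · fin_cases i <;> simp [scaledLiouville, horizontalLift] <;> ring

/-- The curvature of the nonlinear connection of the affine spray. -/
lemma lieBracket_horizontalLift (hφ : DifferentiableAt ℝ φ p.1)
    (hψ : DifferentiableAt ℝ ψ p.1) :
    VectorField.lieBracket ℝ (horizontalLift φ ψ (Pi.single 0 1))
        (horizontalLift φ ψ (Pi.single 1 1)) p
      = scaledLiouville ![partialDeriv 1 φ p.1, -partialDeriv 0 ψ p.1] p := by
  rw [VectorField.lieBracket, (differentiableAt_horizontalLift hφ hψ _).2,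
    (differentiableAt_horizontalLift hφ hψ _).2]
  ext i
  · simp [scaledLiouville]
  · fin_cases i <;> simp [scaledLiouville, horizontalLift, partialDeriv]

variable {U : Set (Fin 2 → ℝ)} {E : (Fin 2 → ℝ) × (Fin 2 → ℝ) → ℝ}

/-- The energy of a metric with geodesic spray `S` is constant along horizontal curves: one
differentiates `S E = 0` in the fibre direction `w` and uses the Euler-Lagrange equations. -/
lemma fderiv_horizontalLift_eq_zero (hU : IsOpen U) (hφ : ContDiffOn ℝ ∞ φ U)
    (hψ : ContDiffOn ℝ ∞ ψ U) (hE : ContDiffOn ℝ ∞ E (positiveCone U))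
    (hhom : ∀ p ∈ positiveCone U, ∀ t : ℝ, 0 < t → E (p.1, t • p.2) = t ^ 2 * E p)
    (hgeo : ∀ p ∈ positiveCone U, ∀ ξ,
      extDeriv (dJ E) p ![affineSpray φ ψ p, ξ] = -(fderiv ℝ E p ξ))
    (hp : p ∈ positiveCone U) (w : Fin 2 → ℝ) :
    fderiv ℝ E p (horizontalLift φ ψ w p) = 0 := by
  have hA := isOpen_positiveCone hU
  have hEp : ContDiffAt ℝ ∞ E p := hE.contDiffAt (hA.mem_nhds hp)
  have hsymm : IsSymmSndFDerivAt ℝ E p := hEp.isSymmSndFDerivAt minSmoothness_two_le_infty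
  have hφp := (hφ.contDiffAt (hU.mem_nhds hp.1)).differentiableAt (by simp)
  have hψp := (hψ.contDiffAt (hU.mem_nhds hp.1)).differentiableAt (by simp)
  have hSd : DifferentiableAt ℝ (affineSpray φ ψ) p :=
    ((contDiffOn_affineSpray hφ hψ).contDiffAt
      ((hU.preimage continuous_fst).mem_nhds hp.1)).differentiableAt (by simp)
  -- the derivative of Euler's relation in the direction `(w, 0)`
  have heuler : fderiv ℝ (fun q => fderiv ℝ E q (liouville q)) p (w, 0)
      = 2 * fderiv ℝ E p (w, 0) := by
    have : (fun q => fderiv ℝ E q (liouville q)) =ᶠ[nhds p] fun q => 2 * E q := by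
      filter_upwards [hA.mem_nhds hp] with q hq
      exact fderiv_liouville_of_homogeneous hhom hq
        ((hE.contDiffAt (hA.mem_nhds hq)).differentiableAt (by simp))
    rw [this.fderiv_eq, fderiv_const_mul (hEp.differentiableAt (by simp))]
    simp
  rw [fderiv_fderiv_apply hEp (hasFDerivAt_liouville p).differentiableAt,
    (hasFDerivAt_liouville p).fderiv] at heuler
  -- the Euler-Lagrange equation
  have hEL := hgeo p hp (w, 0)
  rw [extDeriv_dJ_apply hEp, fderiv_fderiv_apply_const hEp, fderiv_fderiv_apply_const hEp] at hEL
  -- the derivative of the conservation law `S E = 0` in the direction `(0, w)`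
  have hS : fderiv ℝ (fun q => fderiv ℝ E q (affineSpray φ ψ q)) p (0, w) = 0 := by
    have : (fun q => fderiv ℝ E q (affineSpray φ ψ q)) =ᶠ[nhds p] fun _ => 0 := by
      filter_upwards [hA.mem_nhds hp] with q hq
      have h := hgeo q hq (affineSpray φ ψ q)
      rw [extDeriv_dJ_apply (hE.contDiffAt (hA.mem_nhds hq)), sub_self] at h
      linarith
    rw [this.fderiv_eq]
    simp
  rw [fderiv_fderiv_apply hEp hSd, fderiv_affineSpray hφp hψp, hsymm.eq] at hS
  have hsplit : (2 : ℝ) • horizontalLift φ ψ w p = (w, 0) +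
      ((w, ![-(fderiv ℝ φ p.1 (0 : Fin 2 → ℝ) * p.2 0 ^ 2 + 2 * φ p.1 * p.2 0 * w 0),
          -(fderiv ℝ ψ p.1 (0 : Fin 2 → ℝ) * p.2 1 ^ 2 + 2 * ψ p.1 * p.2 1 * w 1)]) :
        (Fin 2 → ℝ) × (Fin 2 → ℝ)) := by
    ext i
    · simp [horizontalLift, two_mul]
    · fin_cases i <;> simp [horizontalLift] <;> ring
  have h2 : 2 * fderiv ℝ E p (horizontalLift φ ψ w p) = 0 := by
    rw [← smul_eq_mul, ← map_smul, hsplit, map_add]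
    have hzero : fderiv ℝ E p (0, 0) = 0 := map_zero _
    simp [liouville, affineSpray] at heuler hEL hS ⊢
    linarith
  linarith

/-- The curvature of the connection annihilates the energy. -/
lemma fderiv_scaledLiouville_curvature (hU : IsOpen U) (hφ : ContDiffOn ℝ ∞ φ U)
    (hψ : ContDiffOn ℝ ∞ ψ U) (hE : ContDiffOn ℝ ∞ E (positiveCone U))
    (hhor : ∀ p ∈ positiveCone U, ∀ w, fderiv ℝ E p (horizontalLift φ ψ w p) = 0)
    (hp : p ∈ positiveCone U) :
    fderiv ℝ E p (scaledLiouville ![partialDeriv 1 φ p.1, -partialDeriv 0 ψ p.1] p) = 0 := by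
  have hA := isOpen_positiveCone hU
  have hφp := (hφ.contDiffAt (hU.mem_nhds hp.1)).differentiableAt (by simp)
  have hψp := (hψ.contDiffAt (hU.mem_nhds hp.1)).differentiableAt (by simp)
  have h0 : ∀ w, (fun q => fderiv ℝ E q (horizontalLift φ ψ w q)) =ᶠ[nhds p] fun _ => 0 := by
    intro w
    filter_upwards [hA.mem_nhds hp] with q hq
    exact hhor q hq w
  rw [← lieBracket_horizontalLift hφp hψp,
    VectorField.fderiv_apply_lieBracket (hE.contDiffAt (hA.mem_nhds hp))
      minSmoothness_two_le_infty
      (differentiableAt_horizontalLift hφp hψp _).1 (differentiableAt_horizontalLift hφp hψp _).1,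
    (h0 _).fderiv_eq, (h0 _).fderiv_eq]
  simp

/-- The logarithmic fibre derivatives of the energy are horizontally constant, because the fields
`scaledLiouville s` commute with the horizontal lifts. -/
lemma fderiv_fderiv_scaledLiouville_horizontalLift (hU : IsOpen U) (hφ : ContDiffOn ℝ ∞ φ U)
    (hψ : ContDiffOn ℝ ∞ ψ U) (hE : ContDiffOn ℝ ∞ E (positiveCone U))
    (hhor : ∀ p ∈ positiveCone U, ∀ w, fderiv ℝ E p (horizontalLift φ ψ w p) = 0)
    (hp : p ∈ positiveCone U) (s w : Fin 2 → ℝ) :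
    fderiv ℝ (fun q => fderiv ℝ E q (scaledLiouville s q)) p (horizontalLift φ ψ w p) = 0 := by
  have hA := isOpen_positiveCone hU
  have hφp := (hφ.contDiffAt (hU.mem_nhds hp.1)).differentiableAt (by simp)
  have hψp := (hψ.contDiffAt (hU.mem_nhds hp.1)).differentiableAt (by simp)
  have h0 : (fun q => fderiv ℝ E q (horizontalLift φ ψ w q)) =ᶠ[nhds p] fun _ => 0 := by
    filter_upwards [hA.mem_nhds hp] with q hq
    exact hhor q hq w
  have h := VectorField.fderiv_apply_lieBracket (hE.contDiffAt (hA.mem_nhds hp))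
      minSmoothness_two_le_infty
    (differentiableAt_horizontalLift hφp hψp w).1 (differentiableAt_scaledLiouville s).1
  rw [lieBracket_scaledLiouville_horizontalLift hφp hψp, h0.fderiv_eq] at h
  simpa using h

lemma contDiffOn_partialDeriv {f : (Fin 2 → ℝ) → ℝ} (hU : IsOpen U) (hf : ContDiffOn ℝ ∞ f U)
    (j : Fin 2) : ContDiffOn ℝ ∞ (partialDeriv j f) U :=
  (hf.fderiv_of_isOpen hU (by simp)).clm_apply contDiffOn_const

/-- The value `a` that metrizability forces on the exponent of `y⁰` in `F`, that is on
`y⁰ ∂(log F)/∂y⁰`. -/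
noncomputable def fibreExponent (φ ψ : (Fin 2 → ℝ) → ℝ) (x : Fin 2 → ℝ) : ℝ :=
  partialDeriv 0 ψ x / (partialDeriv 1 φ x + partialDeriv 0 ψ x)

lemma differentiableOn_fibreExponent (hU : IsOpen U) (hφ : ContDiffOn ℝ ∞ φ U)
    (hψ : ContDiffOn ℝ ∞ ψ U) (hne : ∀ x ∈ U, partialDeriv 1 φ x + partialDeriv 0 ψ x ≠ 0) :
    DifferentiableOn ℝ (fibreExponent φ ψ) U := by
  have h1 := (contDiffOn_partialDeriv hU hφ 1).differentiableOn (by simp)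
  have h2 := (contDiffOn_partialDeriv hU hψ 0).differentiableOn (by simp)
  exact h2.fun_mul ((h1.fun_add h2).inv hne)

lemma scaledLiouville_eq (s : Fin 2 → ℝ) (p : (Fin 2 → ℝ) × (Fin 2 → ℝ)) :
    scaledLiouville s p = (s 0 * p.2 0) • ((0, Pi.single 0 1) : (Fin 2 → ℝ) × (Fin 2 → ℝ))
      + (s 1 * p.2 1) • ((0, Pi.single 1 1) : (Fin 2 → ℝ) × (Fin 2 → ℝ)) := by
  ext i
  · simp [scaledLiouville]
  · fin_cases i <;> simp [scaledLiouville]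

/-- The geodesic spray condition determines the logarithmic fibre derivatives of the energy, and
forces `fibreExponent φ ψ` to be locally constant. -/
lemma fibreExponent_of_isGeodesicSpray (hU : IsOpen U) (hφ : ContDiffOn ℝ ∞ φ U)
    (hψ : ContDiffOn ℝ ∞ ψ U) (hne : ∀ x ∈ U, partialDeriv 1 φ x + partialDeriv 0 ψ x ≠ 0)
    {F : (Fin 2 → ℝ) × (Fin 2 → ℝ) → ℝ} (hF : IsConicPseudoFinsler (positiveCone U) F)
    (hgeo : IsGeodesicSpray (positiveCone U) (affineSpray φ ψ) F) :
    (∀ p ∈ positiveCone U,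
      p.2 0 * fderiv ℝ (fun q => F q ^ 2) p (0, Pi.single 0 1)
          = 2 * fibreExponent φ ψ p.1 * F p ^ 2 ∧
        p.2 1 * fderiv ℝ (fun q => F q ^ 2) p (0, Pi.single 1 1)
          = 2 * (1 - fibreExponent φ ψ p.1) * F p ^ 2) ∧
      ∀ x ∈ U, fderiv ℝ (fibreExponent φ ψ) x = 0 := by
  have hA := isOpen_positiveCone hU
  set E : (Fin 2 → ℝ) × (Fin 2 → ℝ) → ℝ := fun q => F q ^ 2 with hEdef
  have hE : ContDiffOn ℝ ∞ E (positiveCone U) := hF.smooth.pow 2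
  have hhom : ∀ p ∈ positiveCone U, ∀ t : ℝ, 0 < t → E (p.1, t • p.2) = t ^ 2 * E p := by
    intro p hp t ht
    simp only [hEdef, hF.homogeneous p hp t ht]
    ring
  have hhor : ∀ p ∈ positiveCone U, ∀ w, fderiv ℝ E p (horizontalLift φ ψ w p) = 0 :=
    fun p hp w => fderiv_horizontalLift_eq_zero hU hφ hψ hE hhom hgeo hp w
  have hlog : ∀ p ∈ positiveCone U,
      p.2 0 * fderiv ℝ E p (0, Pi.single 0 1) = 2 * fibreExponent φ ψ p.1 * E p ∧
        p.2 1 * fderiv ℝ E p (0, Pi.single 1 1) = 2 * (1 - fibreExponent φ ψ p.1) * E p := by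
    intro p hp
    have h1 := fderiv_scaledLiouville_curvature hU hφ hψ hE hhor hp
    have h2 := fderiv_liouville_of_homogeneous hhom hp
      ((hE.contDiffAt (hA.mem_nhds hp)).differentiableAt (by simp))
    have hC : liouville p = scaledLiouville ![1, 1] p := by
      ext i
      · simp [liouville, scaledLiouville]
      · fin_cases i <;> simp [liouville, scaledLiouville]
    rw [hC] at h2
    rw [scaledLiouville_eq] at h1 h2
    simp only [map_add, map_smul, smul_eq_mul, Matrix.cons_val_zero, Matrix.cons_val_one] at h1 h2
    have hn := hne p.1 hp.1
    rw [fibreExponent]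
    constructor <;> field_simp
    · linear_combination h1 + partialDeriv 0 ψ p.1 * h2
    · linear_combination -h1 + partialDeriv 1 φ p.1 * h2
  refine ⟨hlog, fun x hx => ?_⟩
  have hax : DifferentiableAt ℝ (fibreExponent φ ψ) x :=
    (differentiableOn_fibreExponent hU hφ hψ hne).differentiableAt (hU.mem_nhds hx)
  -- any point of the cone over `x` will do
  let p : (Fin 2 → ℝ) × (Fin 2 → ℝ) := (x, fun _ => 1)
  have hp : p ∈ positiveCone U := ⟨hx, by simp [p], by simp [p]⟩
  ext w
  have h := fderiv_fderiv_scaledLiouville_horizontalLift hU hφ hψ hE hhor hp ![1, 0] w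
  have hEq : (fun q => fderiv ℝ E q (scaledLiouville ![1, 0] q))
      =ᶠ[nhds p] fun q => 2 * (fibreExponent φ ψ q.1 * E q) := by
    filter_upwards [hA.mem_nhds hp] with q hq
    rw [scaledLiouville_eq, map_add, map_smul, map_smul]
    simpa [mul_assoc] using (hlog q hq).1
  have hd : HasFDerivAt (fun q => 2 * (fibreExponent φ ψ q.1 * E q)) _ p :=
    ((hasFDerivAt_comp_fst hax.hasFDerivAt).fun_mul
      ((hE.contDiffAt (hA.mem_nhds hp)).differentiableAt (by simp)).hasFDerivAt).const_mul 2
  rw [hEq.fderiv_eq, hd.fderiv] at h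
  have hpos : E p ≠ 0 := pow_ne_zero 2 (hF.pos p hp).ne'
  have hh := hhor p hp w
  simp [hh, hpos] at h
  simpa [horizontalLift, p] using h

/-- If the energy does not depend on one fibre coordinate, then `d d_J F²` is degenerate. -/
lemma exists_fderiv_fibre_ne_zero (hU : IsOpen U) {F : (Fin 2 → ℝ) × (Fin 2 → ℝ) → ℝ}
    (hF : IsConicPseudoFinsler (positiveCone U) F) (hne : U.Nonempty) (j : Fin 2) :
    ∃ p ∈ positiveCone U, fderiv ℝ (fun q => F q ^ 2) p (0, Pi.single j 1) ≠ 0 := by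
  by_contra! hzero
  have hA := isOpen_positiveCone hU
  obtain ⟨x, hx⟩ := hne
  let p : (Fin 2 → ℝ) × (Fin 2 → ℝ) := (x, fun _ => 1)
  have hp : p ∈ positiveCone U := ⟨hx, by simp [p], by simp [p]⟩
  have hE : ContDiffAt ℝ ∞ (fun q => F q ^ 2) p := (hF.smooth.contDiffAt (hA.mem_nhds hp)).pow 2
  have hsymm := hE.isSymmSndFDerivAt minSmoothness_two_le_infty
  have h0 : (fun q => fderiv ℝ (fun q => F q ^ 2) q (0, Pi.single j 1)) =ᶠ[nhds p] fun _ => 0 := by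
    filter_upwards [hA.mem_nhds hp] with q hq
    exact hzero q hq
  have key := hF.symplectic.nondegenerate p hp (0, Pi.single j 1) fun η => by
    rw [extDeriv_dJ_apply hE, fderiv_fderiv_apply_const hE, hsymm.eq,
      ← fderiv_fderiv_apply_const hE, h0.fderiv_eq]
    have : ((0 : Fin 2 → ℝ), ((0 : Fin 2 → ℝ), (Pi.single j 1 : Fin 2 → ℝ)).1) = 0 := rfl
    simp [this]
  have := congr_fun (congr_arg Prod.snd key) j
  simp at this

/-- Necessity of the condition; only local metrizability is used, because `fibreExponent φ ψ` does
not depend on the local metric. -/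
theorem exists_constant_of_locally_metrizable {M : Set (Fin 2 → ℝ)} (hMo : IsOpen M)
    (hMc : IsConnected M) (hφ : ContDiffOn ℝ ∞ φ M) (hψ : ContDiffOn ℝ ∞ ψ M)
    (hne : ∀ x ∈ M, partialDeriv 1 φ x + partialDeriv 0 ψ x ≠ 0)
    (hloc : ∀ x ∈ M, ∃ U : Set (Fin 2 → ℝ), IsOpen U ∧ x ∈ U ∧ U ⊆ M ∧
      IsConicMetrizable (positiveCone U) (affineSpray φ ψ)) :
    ∃ c : ℝ, c ≠ 0 ∧ c ≠ 1 ∧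
      ∀ x ∈ M, c * partialDeriv 1 φ x = (1 - c) * partialDeriv 0 ψ x := by
  have hd0 : ∀ x ∈ M, fderiv ℝ (fibreExponent φ ψ) x = 0 := by
    intro x hx
    obtain ⟨U, hU, hxU, hUM, F, hF, hgeo⟩ := hloc x hx
    exact (fibreExponent_of_isGeodesicSpray hU (hφ.mono hUM) (hψ.mono hUM)
      (fun y hy => hne y (hUM hy)) hF hgeo).2 x hxU
  obtain ⟨c, hc⟩ := hMo.exists_is_const_of_fderiv_eq_zero hMc.isPreconnected
    (differentiableOn_fibreExponent hMo hφ hψ hne) hd0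
  obtain ⟨x, hx⟩ := hMc.nonempty
  obtain ⟨U, hU, hxU, hUM, F, hF, hgeo⟩ := hloc x hx
  have hlog := (fibreExponent_of_isGeodesicSpray hU (hφ.mono hUM) (hψ.mono hUM)
      (fun y hy => hne y (hUM hy)) hF hgeo).1
  refine ⟨c, ?_, ?_, fun y hy => ?_⟩
  · rintro rfl
    obtain ⟨p, hp, hp0⟩ := exists_fderiv_fibre_ne_zero hU hF ⟨x, hxU⟩ 0
    have h := (hlog p hp).1
    rw [hc p.1 (hUM hp.1)] at h
    simp [hp.2.1.ne', hp0] at h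
  · rintro rfl
    obtain ⟨p, hp, hp0⟩ := exists_fderiv_fibre_ne_zero hU hF ⟨x, hxU⟩ 1
    have h := (hlog p hp).2
    rw [hc p.1 (hUM hp.1)] at h
    simp [hp.2.2.ne', hp0] at h
  · have h := hc y hy
    rw [fibreExponent, div_eq_iff (hne y hy)] at h
    linear_combination -h

end Necessity

/-! ### Sufficiency: the metrics `exp θ · (y⁰)ᶜ (y¹)¹⁻ᶜ` -/

section Sufficiency

/-- The logarithm `θ(x) + c log y⁰ + (1 - c) log y¹` of the metrics that metrize affine sprays. -/
noncomputable def logMetric (c : ℝ) (θ : (Fin 2 → ℝ) → ℝ) (p : (Fin 2 → ℝ) × (Fin 2 → ℝ)) : ℝ :=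
  θ p.1 + c * Real.log (p.2 0) + (1 - c) * Real.log (p.2 1)

/-- The fibre derivative of `logMetric c θ` in the direction `w`. -/
noncomputable def logMetricFibreDeriv (c : ℝ) (y w : Fin 2 → ℝ) : ℝ :=
  c * (w 0 / y 0) + (1 - c) * (w 1 / y 1)

variable {φ ψ θ : (Fin 2 → ℝ) → ℝ} {U : Set (Fin 2 → ℝ)} {c : ℝ}
  {F : (Fin 2 → ℝ) × (Fin 2 → ℝ) → ℝ} {p : (Fin 2 → ℝ) × (Fin 2 → ℝ)}

lemma contDiffOn_logMetric (hθ : ContDiffOn ℝ ∞ θ U) :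
    ContDiffOn ℝ ∞ (logMetric c θ) (positiveCone U) := by
  have hx : ContDiffOn ℝ ∞ (Prod.fst : (Fin 2 → ℝ) × (Fin 2 → ℝ) → _) (positiveCone U) :=
    contDiffOn_fst
  have hy : ∀ i : Fin 2, ContDiffOn ℝ ∞
      (fun p : (Fin 2 → ℝ) × (Fin 2 → ℝ) => p.2 i) (positiveCone U) := fun i => by fun_prop
  have h1 := hθ.comp hx fun p hp => hp.1
  exact (h1.add (contDiffOn_const.mul ((hy 0).log fun p hp => hp.2.1.ne'))).add
    (contDiffOn_const.mul ((hy 1).log fun p hp => hp.2.2.ne'))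

lemma fderiv_logMetric (hθ : HasFDerivAt θ (fderiv ℝ θ p.1) p.1) (h0 : 0 < p.2 0)
    (h1 : 0 < p.2 1) (v : (Fin 2 → ℝ) × (Fin 2 → ℝ)) :
    fderiv ℝ (logMetric c θ) p v = fderiv ℝ θ p.1 v.1 + logMetricFibreDeriv c p.2 v.2 := by
  have h : HasFDerivAt (logMetric c θ) _ p :=
    ((hasFDerivAt_comp_fst hθ).fun_add
      (((hasFDerivAt_fibre_coord 0 p).log h0.ne').const_mul c)).fun_add
      (((hasFDerivAt_fibre_coord 1 p).log h1.ne').const_mul (1 - c))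
  rw [h.fderiv]
  simp [logMetricFibreDeriv]
  ring

lemma differentiableAt_logMetricFibreDeriv (h0 : 0 < p.2 0) (h1 : 0 < p.2 1) (w : Fin 2 → ℝ) :
    DifferentiableAt ℝ (fun q : (Fin 2 → ℝ) × (Fin 2 → ℝ) => logMetricFibreDeriv c q.2 w) p ∧
      ∀ v, fderiv ℝ (fun q : (Fin 2 → ℝ) × (Fin 2 → ℝ) => logMetricFibreDeriv c q.2 w) p v
        = -(c * (w 0 * v.2 0 / p.2 0 ^ 2) + (1 - c) * (w 1 * v.2 1 / p.2 1 ^ 2)) := by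
  have hinv : ∀ i, 0 < p.2 i →
      HasFDerivAt (fun q : (Fin 2 → ℝ) × (Fin 2 → ℝ) => (q.2 i)⁻¹) _ p := fun i hi =>
    (hasDerivAt_inv hi.ne').comp_hasFDerivAt p (hasFDerivAt_fibre_coord i p)
  have h : HasFDerivAt (fun q : (Fin 2 → ℝ) × (Fin 2 → ℝ) => logMetricFibreDeriv c q.2 w) _ p :=
    (((hinv 0 h0).const_mul (w 0)).const_mul c).fun_add
      (((hinv 1 h1).const_mul (w 1)).const_mul (1 - c))
  refine ⟨h.differentiableAt, fun v => ?_⟩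
  rw [h.fderiv]
  simp
  field_simp
  ring

lemma fderiv_metric (hU : IsOpen U) (hθ : ContDiffOn ℝ ∞ θ U)
    (hF : ∀ p ∈ positiveCone U, F p = Real.exp (logMetric c θ p))
    (hp : p ∈ positiveCone U) (v : (Fin 2 → ℝ) × (Fin 2 → ℝ)) :
    fderiv ℝ F p v = F p * (fderiv ℝ θ p.1 v.1 + logMetricFibreDeriv c p.2 v.2) := by
  have hA := isOpen_positiveCone hU
  have heq : F =ᶠ[nhds p] fun q => Real.exp (logMetric c θ q) := by
    filter_upwards [hA.mem_nhds hp] with q hq using hF q hq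
  have hL : DifferentiableAt ℝ (logMetric c θ) p :=
    ((contDiffOn_logMetric hθ).contDiffAt (hA.mem_nhds hp)).differentiableAt (by simp)
  rw [heq.fderiv_eq, hL.hasFDerivAt.exp.fderiv, hF p hp, ← fderiv_logMetric
    ((hθ.contDiffAt (hU.mem_nhds hp.1)).differentiableAt (by simp)).hasFDerivAt hp.2.1 hp.2.2]
  rfl

lemma contDiffOn_metric (hθ : ContDiffOn ℝ ∞ θ U)
    (hF : ∀ p ∈ positiveCone U, F p = Real.exp (logMetric c θ p)) :
    ContDiffOn ℝ ∞ F (positiveCone U) :=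
  (contDiffOn_logMetric hθ).exp.congr hF

lemma fderiv_energy (hU : IsOpen U) (hθ : ContDiffOn ℝ ∞ θ U)
    (hF : ∀ p ∈ positiveCone U, F p = Real.exp (logMetric c θ p))
    (hp : p ∈ positiveCone U) (v : (Fin 2 → ℝ) × (Fin 2 → ℝ)) :
    fderiv ℝ (fun q => F q ^ 2) p v
      = 2 * F p ^ 2 * (fderiv ℝ θ p.1 v.1 + logMetricFibreDeriv c p.2 v.2) := by
  have hd := (((contDiffOn_metric hθ hF).contDiffAt
    ((isOpen_positiveCone hU).mem_nhds hp)).differentiableAt (by simp)).hasFDerivAt.pow 2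
  rw [hd.fderiv]
  simp [fderiv_metric hU hθ hF hp]
  ring

/-- The derivative of the fibre derivative of the energy. -/
lemma fderiv_fderiv_energy (hU : IsOpen U) (hθ : ContDiffOn ℝ ∞ θ U)
    (hF : ∀ p ∈ positiveCone U, F p = Real.exp (logMetric c θ p))
    (hp : p ∈ positiveCone U) (w : Fin 2 → ℝ)
    (v : (Fin 2 → ℝ) × (Fin 2 → ℝ)) :
    fderiv ℝ (fun q => fderiv ℝ (fun q => F q ^ 2) q (0, w)) p v
      = 2 * F p ^ 2 * (2 * (fderiv ℝ θ p.1 v.1 + logMetricFibreDeriv c p.2 v.2)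
          * logMetricFibreDeriv c p.2 w
        - (c * (w 0 * v.2 0 / p.2 0 ^ 2) + (1 - c) * (w 1 * v.2 1 / p.2 1 ^ 2))) := by
  have hA := isOpen_positiveCone hU
  have heq : (fun q => fderiv ℝ (fun q => F q ^ 2) q (0, w)) =ᶠ[nhds p]
      fun q => 2 * (F q ^ 2 * logMetricFibreDeriv c q.2 w) := by
    filter_upwards [hA.mem_nhds hp] with q hq
    rw [fderiv_energy hU hθ hF hq]
    simp [mul_assoc]
  have hE : DifferentiableAt ℝ (fun q => F q ^ 2) p :=
    (((contDiffOn_metric hθ hF).pow 2).contDiffAt (hA.mem_nhds hp)).differentiableAt (by simp)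
  have hL := differentiableAt_logMetricFibreDeriv (c := c) hp.2.1 hp.2.2 w
  rw [heq.fderiv_eq, ((hE.hasFDerivAt.fun_mul hL.1.hasFDerivAt).const_mul 2).fderiv]
  simp [hL.2, fderiv_energy hU hθ hF hp]
  ring

lemma extDeriv_dJ_energy (hU : IsOpen U) (hθ : ContDiffOn ℝ ∞ θ U)
    (hF : ∀ p ∈ positiveCone U, F p = Real.exp (logMetric c θ p))
    (hp : p ∈ positiveCone U) (u v : (Fin 2 → ℝ) × (Fin 2 → ℝ)) :
    extDeriv (dJ fun q => F q ^ 2) p ![u, v]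
      = 2 * F p ^ 2 * (2 * (fderiv ℝ θ p.1 u.1 + logMetricFibreDeriv c p.2 u.2)
          * logMetricFibreDeriv c p.2 v.1
        - (c * (v.1 0 * u.2 0 / p.2 0 ^ 2) + (1 - c) * (v.1 1 * u.2 1 / p.2 1 ^ 2)))
      - 2 * F p ^ 2 * (2 * (fderiv ℝ θ p.1 v.1 + logMetricFibreDeriv c p.2 v.2)
          * logMetricFibreDeriv c p.2 u.1
        - (c * (u.1 0 * v.2 0 / p.2 0 ^ 2) + (1 - c) * (u.1 1 * v.2 1 / p.2 1 ^ 2))) := by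
  rw [extDeriv_dJ_apply (((contDiffOn_metric hθ hF).pow 2).contDiffAt
      ((isOpen_positiveCone hU).mem_nhds hp)),
    fderiv_fderiv_energy hU hθ hF hp, fderiv_fderiv_energy hU hθ hF hp]

/-- The fibre Hessian of the energy of `logMetric c θ` is nondegenerate when `c ≠ 0, 1`. -/
lemma eq_zero_of_fibreHessian_eq_zero (hc0 : c ≠ 0) (hc1 : c ≠ 1) {y w : Fin 2 → ℝ}
    (h0 : 0 < y 0) (h1 : 0 < y 1)
    (h : ∀ z : Fin 2 → ℝ, 2 * logMetricFibreDeriv c y z * logMetricFibreDeriv c y w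
      = c * (w 0 * z 0 / y 0 ^ 2) + (1 - c) * (w 1 * z 1 / y 1 ^ 2)) : w = 0 := by
  have hc1' : 1 - c ≠ 0 := sub_ne_zero.2 hc1.symm
  have e0 := h ![y 0, 0]
  have e1 := h ![0, y 1]
  simp only [logMetricFibreDeriv, Matrix.cons_val_zero, Matrix.cons_val_one, zero_div, mul_zero,
    add_zero, zero_add, div_self h0.ne', div_self h1.ne', mul_one] at e0 e1
  have f0 : w 0 * y 0 / y 0 ^ 2 = w 0 / y 0 := by field_simp
  have f1 : w 1 * y 1 / y 1 ^ 2 = w 1 / y 1 := by field_simp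
  rw [f0] at e0
  rw [f1] at e1
  -- both `wⁱ / yⁱ` equal twice their weighted mean, whose weights add up to `1`
  have g0 : 2 * (c * (w 0 / y 0) + (1 - c) * (w 1 / y 1)) = w 0 / y 0 :=
    mul_left_cancel₀ hc0 (by linear_combination e0)
  have g1 : 2 * (c * (w 0 / y 0) + (1 - c) * (w 1 / y 1)) = w 1 / y 1 :=
    mul_left_cancel₀ hc1' (by linear_combination e1)
  have hm : c * (w 0 / y 0) + (1 - c) * (w 1 / y 1) = 0 := by
    linear_combination c * g0 + (1 - c) * g1
  rw [hm, mul_zero, eq_comm] at g0 g1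
  ext i
  fin_cases i
  · simpa [h0.ne'] using g0
  · simpa [h1.ne'] using g1

lemma isConicPseudoFinsler_metric (hU : IsOpen U) (hθ : ContDiffOn ℝ ∞ θ U)
    (hF : ∀ p ∈ positiveCone U, F p = Real.exp (logMetric c θ p))
    (hc0 : c ≠ 0) (hc1 : c ≠ 1) :
    IsConicPseudoFinsler (positiveCone U) F where
  region := isConicRegion_positiveCone hU
  smooth := contDiffOn_metric hθ hF
  pos p hp := by rw [hF p hp]; exact Real.exp_pos _
  homogeneous p hp t ht := by
    rw [hF p hp, hF _ ((isConicRegion_positiveCone hU).smul_mem p hp t ht)]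
    have : logMetric c θ (p.1, t • p.2) = Real.log t + logMetric c θ p := by
      simp only [logMetric, Pi.smul_apply, smul_eq_mul, Real.log_mul ht.ne' hp.2.1.ne',
        Real.log_mul ht.ne' hp.2.2.ne']
      ring
    rw [this, Real.exp_add, Real.exp_log ht]
  symplectic := by
    have hA := isOpen_positiveCone hU
    have hE : ∀ p ∈ positiveCone U, ContDiffAt ℝ ∞ (fun q => F q ^ 2) p := fun p hp =>
      ((contDiffOn_metric hθ hF).pow 2).contDiffAt (hA.mem_nhds hp)
    refine ⟨fun p hp => (contDiffAt_extDeriv_dJ (hE p hp)).contDiffWithinAt, fun p hp =>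
      extDeriv_extDeriv_apply (contDiffAt_dJ (hE p hp)) minSmoothness_two_le_infty,
      fun p hp ξ h => ?_⟩
    have hFp : F p ≠ 0 := by
      rw [hF p hp]
      exact Real.exp_ne_zero _
    have hx : ξ.1 = 0 := by
      refine eq_zero_of_fibreHessian_eq_zero hc0 hc1 hp.2.1 hp.2.2 fun z => ?_
      have hz := h (0, z)
      rw [extDeriv_dJ_energy hU hθ hF hp] at hz
      simp [logMetricFibreDeriv, hFp] at hz
      simp only [logMetricFibreDeriv]
      linear_combination hz
    have hy : ξ.2 = 0 := by
      refine eq_zero_of_fibreHessian_eq_zero hc0 hc1 hp.2.1 hp.2.2 fun z => ?_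
      have hz := h (z, 0)
      rw [extDeriv_dJ_energy hU hθ hF hp] at hz
      simp [logMetricFibreDeriv, hx, hFp] at hz
      simp only [logMetricFibreDeriv]
      linear_combination hz
    exact Prod.ext hx hy

lemma isGeodesicSpray_metric (hU : IsOpen U) (hθ : ContDiffOn ℝ ∞ θ U)
    (hF : ∀ p ∈ positiveCone U, F p = Real.exp (logMetric c θ p))
    (hdθ : ∀ x ∈ U, ∀ u, fderiv ℝ θ x u = c * φ x * u 0 + (1 - c) * ψ x * u 1) :
    IsGeodesicSpray (positiveCone U) (affineSpray φ ψ) F := by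
  intro p hp ξ
  rw [extDeriv_dJ_energy hU hθ hF hp, fderiv_energy hU hθ hF hp]
  simp only [hdθ p.1 hp.1, logMetricFibreDeriv, affineSpray, Matrix.cons_val_zero,
    Matrix.cons_val_one]
  have h0 := hp.2.1.ne'
  have h1 := hp.2.2.ne'
  field_simp
  ring

/-- Sufficiency of the condition on an open set where closed `1`-forms are exact: the form
`c φ dx⁰ + (1 - c) ψ dx¹` is closed by the condition on `c`, and for a primitive `θ` of it the
function `exp (logMetric c θ)` metrizes the affine spray. -/
lemma isConicMetrizable_of_primitives (hU : IsOpen U) (hφ : ContDiffOn ℝ ∞ φ U)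
    (hψ : ContDiffOn ℝ ∞ ψ U) (hc0 : c ≠ 0) (hc1 : c ≠ 1)
    (hc : ∀ x ∈ U, c * partialDeriv 1 φ x = (1 - c) * partialDeriv 0 ψ x)
    (hprim : ∀ η : (Fin 2 → ℝ) → (Fin 2 → ℝ) →L[ℝ] ℝ, DifferentiableOn ℝ η U →
      (∀ a ∈ U, ∀ x y, fderiv ℝ η a x y = fderiv ℝ η a y x) →
      ∃ f : (Fin 2 → ℝ) → ℝ, ∀ a ∈ U, HasFDerivAt f (η a) a) :
    IsConicMetrizable (positiveCone U) (affineSpray φ ψ) := by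
  let dx : Fin 2 → ((Fin 2 → ℝ) →L[ℝ] ℝ) := fun i => ContinuousLinearMap.proj i
  let η : (Fin 2 → ℝ) → (Fin 2 → ℝ) →L[ℝ] ℝ := fun x =>
    (c * φ x) • dx 0 + ((1 - c) * ψ x) • dx 1
  have hη : ContDiffOn ℝ ∞ η U :=
    ((contDiffOn_const.mul hφ).smul contDiffOn_const).add
      ((contDiffOn_const.mul hψ).smul contDiffOn_const)
  obtain ⟨θ, hθ⟩ := hprim η (hη.differentiableOn (by simp)) fun a ha u v => by
    have h1 := ((hφ.contDiffAt (hU.mem_nhds ha)).differentiableAt (by simp)).hasFDerivAt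
    have h2 := ((hψ.contDiffAt (hU.mem_nhds ha)).differentiableAt (by simp)).hasFDerivAt
    have h : HasFDerivAt η _ a :=
      ((h1.const_mul c).smul_const (dx 0)).fun_add ((h2.const_mul (1 - c)).smul_const (dx 1))
    rw [h.fderiv]
    simp [dx, fderiv_apply_eq_partialDeriv]
    linear_combination (u 1 * v 0 - v 1 * u 0) * hc a ha
  have hθs : ContDiffOn ℝ ∞ θ U := by
    rw [contDiffOn_infty_iff_fderiv_of_isOpen hU]
    exact ⟨fun x hx => (hθ x hx).differentiableAt.differentiableWithinAt,
      hη.congr fun x hx => (hθ x hx).fderiv⟩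
  refine ⟨fun p => Real.exp (logMetric c θ p),
    isConicPseudoFinsler_metric hU hθs (fun _ _ => rfl) hc0 hc1,
    isGeodesicSpray_metric hU hθs (fun _ _ => rfl) fun x hx u => ?_⟩
  rw [(hθ x hx).fderiv]
  simp [η, dx]

end Sufficiency

/-! ### The metric `√(y⁰ y¹) / |g(x⁰ + x¹)|` -/

section Explicit

variable {M : Set (Fin 2 → ℝ)} {I : Set ℝ}

lemma hasFDerivAt_comp_coord_add {h : ℝ → ℝ} {x : Fin 2 → ℝ}
    (hh : DifferentiableAt ℝ h (x 0 + x 1)) :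
    HasFDerivAt (fun x : Fin 2 → ℝ => h (x 0 + x 1))
      (deriv h (x 0 + x 1) • ((ContinuousLinearMap.proj 0 : (Fin 2 → ℝ) →L[ℝ] ℝ)
        + ContinuousLinearMap.proj 1)) x :=
  hh.hasDerivAt.comp_hasFDerivAt x ((hasFDerivAt_apply 0 x).fun_add (hasFDerivAt_apply 1 x))

lemma partialDeriv_comp_coord_add {h : ℝ → ℝ} {x : Fin 2 → ℝ}
    (hh : DifferentiableAt ℝ h (x 0 + x 1)) (j : Fin 2) :
    partialDeriv j (fun x : Fin 2 → ℝ => h (x 0 + x 1)) x = deriv h (x 0 + x 1) := by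
  rw [partialDeriv, (hasFDerivAt_comp_coord_add hh).fderiv]
  fin_cases j <;> simp

lemma contDiffOn_comp_coord_add {h : ℝ → ℝ} (hh : ContDiffOn ℝ ∞ h I)
    (hM : ∀ x ∈ M, x 0 + x 1 ∈ I) :
    ContDiffOn ℝ ∞ (fun x : Fin 2 → ℝ => h (x 0 + x 1)) M := by
  have hs : ContDiffOn ℝ ∞ (fun x : Fin 2 → ℝ => x 0 + x 1) M := by fun_prop
  exact hh.comp hs hM

/-- The explicit metric is `exp (logMetric c θ)` with `c = 1 / 2` and `θ = -log |g|`; the absolute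
value is part of the convention for `Real.log`. -/
lemma sqrt_div_eq_exp_logMetric {g : ℝ → ℝ} {p : (Fin 2 → ℝ) × (Fin 2 → ℝ)}
    (h0 : 0 < p.2 0) (h1 : 0 < p.2 1) (hg : g (p.1 0 + p.1 1) ≠ 0) :
    Real.sqrt (p.2 0 * p.2 1) / |g (p.1 0 + p.1 1)|
      = Real.exp (logMetric (1 / 2) (fun x => -Real.log (g (x 0 + x 1))) p) := by
  have hpos : 0 < Real.sqrt (p.2 0 * p.2 1) / |g (p.1 0 + p.1 1)| := by positivity
  rw [← Real.exp_log hpos, Real.log_div (by positivity) (by positivity), Real.log_abs,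
    Real.log_sqrt (by positivity), Real.log_mul h0.ne' h1.ne', logMetric]
  congr 1
  ring

lemma explicit_metric (hMo : IsOpen M) {g : ℝ → ℝ} (hI : IsOpen I) (hg : ContDiffOn ℝ ∞ g I)
    (hg0 : ∀ t ∈ I, g t ≠ 0) (hM : ∀ x ∈ M, x 0 + x 1 ∈ I) {φ : (Fin 2 → ℝ) → ℝ}
    (hφ : ∀ x, φ x = -(2 * deriv g (x 0 + x 1) / g (x 0 + x 1)))
    {F : (Fin 2 → ℝ) × (Fin 2 → ℝ) → ℝ}
    (hF : ∀ p, F p = Real.sqrt (p.2 0 * p.2 1) / |g (p.1 0 + p.1 1)|) :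
    (∀ x ∈ M, (1 / 2 : ℝ) * partialDeriv 1 φ x = (1 - 1 / 2 : ℝ) * partialDeriv 0 φ x) ∧
      IsConicPseudoFinsler (positiveCone M) F ∧
      IsGeodesicSpray (positiveCone M) (affineSpray φ φ) F ∧
      HasScalarFlagCurvature (positiveCone M) (affineSpray φ φ) F
        (fun p => 4 * (deriv (deriv g) (p.1 0 + p.1 1) * g (p.1 0 + p.1 1)
          - deriv g (p.1 0 + p.1 1) ^ 2)) := by
  have hg' : ContDiffOn ℝ ∞ (deriv g) I := hg.deriv_of_isOpen hI (by simp)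
  have hg'' : ContDiffOn ℝ ∞ (deriv (deriv g)) I := hg'.deriv_of_isOpen hI (by simp)
  have hdg : ∀ t ∈ I, HasDerivAt g (deriv g t) t := fun t ht =>
    ((hg.contDiffAt (hI.mem_nhds ht)).differentiableAt (by simp)).hasDerivAt
  have hdg' : ∀ t ∈ I, HasDerivAt (deriv g) (deriv (deriv g) t) t := fun t ht =>
    ((hg'.contDiffAt (hI.mem_nhds ht)).differentiableAt (by simp)).hasDerivAt
  -- `φ` is `h (x⁰ + x¹)` with `h = -2 g' / g`
  have hh : ∀ t ∈ I, HasDerivAt (fun t => -(2 * deriv g t / g t))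
      (-(2 * (deriv (deriv g) t * g t - deriv g t ^ 2) / g t ^ 2)) t := fun t ht => by
    convert! (((hdg' t ht).const_mul 2).fun_div (hdg t ht) (hg0 t ht)).fun_neg using 1
    ring
  have hφ' : φ = fun x => (fun t => -(2 * deriv g t / g t)) (x 0 + x 1) := funext hφ
  have hφd : ∀ x ∈ M, DifferentiableAt ℝ φ x := fun x hx => by
    rw [hφ']
    exact (hasFDerivAt_comp_coord_add (hh _ (hM x hx)).differentiableAt).differentiableAt
  have hpd : ∀ x ∈ M, ∀ j, partialDeriv j φ x
      = -(2 * (deriv (deriv g) (x 0 + x 1) * g (x 0 + x 1) - deriv g (x 0 + x 1) ^ 2)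
        / g (x 0 + x 1) ^ 2) := fun x hx j => by
    rw [hφ', partialDeriv_comp_coord_add (hh _ (hM x hx)).differentiableAt,
      (hh _ (hM x hx)).deriv]
  let θ : (Fin 2 → ℝ) → ℝ := fun x => -Real.log (g (x 0 + x 1))
  have hθ : ContDiffOn ℝ ∞ θ M :=
    ((contDiffOn_comp_coord_add hg hM).log fun x hx => hg0 _ (hM x hx)).neg
  have hdθ : ∀ x ∈ M, ∀ u,
      fderiv ℝ θ x u = 1 / 2 * φ x * u 0 + (1 - 1 / 2) * φ x * u 1 := fun x hx u => by
    have h : HasFDerivAt θ _ x := ((hasFDerivAt_comp_coord_add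
      (hdg _ (hM x hx)).differentiableAt).log (hg0 _ (hM x hx))).neg
    rw [h.fderiv, hφ]
    simp
    ring
  have hFexp : ∀ p ∈ positiveCone M, F p = Real.exp (logMetric (1 / 2) θ p) := fun p hp => by
    rw [hF, sqrt_div_eq_exp_logMetric hp.2.1 hp.2.2 (hg0 _ (hM _ hp.1))]
  refine ⟨fun x hx => ?_, isConicPseudoFinsler_metric hMo hθ hFexp (by norm_num) (by norm_num),
    isGeodesicSpray_metric hMo hθ hFexp hdθ, ?_, fun p hp u => ?_⟩
  · rw [hpd x hx, hpd x hx]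
    norm_num
  · have hκ := contDiffOn_const (c := (4 : ℝ)) |>.mul
      (((contDiffOn_comp_coord_add hg'' hM).mul (contDiffOn_comp_coord_add hg hM)).sub
        ((contDiffOn_comp_coord_add hg' hM).pow 2))
    have hx : ContDiffOn ℝ ∞ (Prod.fst : (Fin 2 → ℝ) × (Fin 2 → ℝ) → _) (positiveCone M) :=
      contDiffOn_fst
    exact hκ.comp hx fun p hp => hp.1
  · have hy0 := hp.2.1
    have hy1 := hp.2.2
    have hgp := hg0 _ (hM _ hp.1)
    have hF2 : F p ^ 2 = p.2 0 * p.2 1 / g (p.1 0 + p.1 1) ^ 2 := by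
      rw [hF, div_pow, Real.sq_sqrt (by positivity), sq_abs]
    rw [jacobiEndomorphism_affineSpray (hφd _ hp.1) (hφd _ hp.1), hpd _ hp.1, hpd _ hp.1,
      tangentJ_apply, fderiv_metric hMo hθ hFexp hp, ← mul_assoc, ← sq, hF2]
    ext i
    fin_cases i
    · simp [logMetricFibreDeriv]
      field_simp
      ring
    · simp [logMetricFibreDeriv]
      field_simp
      ring

end Explicit

end FinslerSpray

/-! ### The characterization of metrizability and the explicit metric -/

theorem mainTheorem2 (M : Set (Fin 2 → ℝ)) (hMo : IsOpen M) (hMc : IsConnected M) :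
    -- the characterization of metrizability
    (∀ φ ψ : (Fin 2 → ℝ) → ℝ, ContDiffOn ℝ ∞ φ M → ContDiffOn ℝ ∞ ψ M →
      IsSpray M (affineSpray φ ψ) ∧
      (∀ p : (Fin 2 → ℝ) × (Fin 2 → ℝ), p.1 ∈ M →
        ricciScalar (affineSpray φ ψ) p
          = -(p.2 0 * p.2 1 * (partialDeriv 1 φ p.1 + partialDeriv 0 ψ p.1))) ∧
      ((∀ p ∈ positiveCone M, ricciScalar (affineSpray φ ψ) p ≠ 0) →
        ((∀ x ∈ M, ∃ U : Set (Fin 2 → ℝ), IsOpen U ∧ x ∈ U ∧ U ⊆ M ∧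
            IsConicMetrizable (positiveCone U) (affineSpray φ ψ)) ↔
          ∃ c : ℝ, c ≠ 0 ∧ c ≠ 1 ∧
            ∀ x ∈ M, c * partialDeriv 1 φ x = (1 - c) * partialDeriv 0 ψ x) ∧
        (IsConicMetrizable (positiveCone M) (affineSpray φ ψ) →
          ∃ c : ℝ, c ≠ 0 ∧ c ≠ 1 ∧
            ∀ x ∈ M, c * partialDeriv 1 φ x = (1 - c) * partialDeriv 0 ψ x) ∧
        (IsSimplyConnected M →
          (IsConicMetrizable (positiveCone M) (affineSpray φ ψ) ↔
            ∃ c : ℝ, c ≠ 0 ∧ c ≠ 1 ∧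
              ∀ x ∈ M, c * partialDeriv 1 φ x = (1 - c) * partialDeriv 0 ψ x)))) ∧
    -- the explicit metric
    (∀ (I : Set ℝ) (g : ℝ → ℝ), IsOpen I → ContDiffOn ℝ ∞ g I → (∀ t ∈ I, g t ≠ 0) →
      (∀ x ∈ M, x 0 + x 1 ∈ I) →
      ∀ φ : (Fin 2 → ℝ) → ℝ, (∀ x, φ x = -(2 * deriv g (x 0 + x 1) / g (x 0 + x 1))) →
      ∀ F : (Fin 2 → ℝ) × (Fin 2 → ℝ) → ℝ,
        (∀ p, F p = Real.sqrt (p.2 0 * p.2 1) / |g (p.1 0 + p.1 1)|) →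
      (∀ x ∈ M, (1 / 2 : ℝ) * partialDeriv 1 φ x = (1 - 1 / 2 : ℝ) * partialDeriv 0 φ x) ∧
      IsConicPseudoFinsler (positiveCone M) F ∧
      IsGeodesicSpray (positiveCone M) (affineSpray φ φ) F ∧
      HasScalarFlagCurvature (positiveCone M) (affineSpray φ φ) F
        (fun p => 4 * (deriv (deriv g) (p.1 0 + p.1 1) * g (p.1 0 + p.1 1)
          - deriv g (p.1 0 + p.1 1) ^ 2))) := by
  refine ⟨fun φ ψ hφ hψ => ?_, fun I g hI hg hg0 hM φ hφ F hF =>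
    explicit_metric hMo hI hg hg0 hM hφ hF⟩
  have hd : ∀ {f : (Fin 2 → ℝ) → ℝ}, ContDiffOn ℝ ∞ f M → ∀ x ∈ M, DifferentiableAt ℝ f x :=
    fun hf x hx => (hf.contDiffAt (hMo.mem_nhds hx)).differentiableAt (by simp)
  have hricci : ∀ p : (Fin 2 → ℝ) × (Fin 2 → ℝ), p.1 ∈ M →
      ricciScalar (affineSpray φ ψ) p
        = -(p.2 0 * p.2 1 * (partialDeriv 1 φ p.1 + partialDeriv 0 ψ p.1)) := fun p hp =>
    ricciScalar_affineSpray (hd hφ _ hp) (hd hψ _ hp)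
  refine ⟨isSpray_affineSpray hMo hφ hψ, hricci, fun hρ => ?_⟩
  have hne : ∀ x ∈ M, partialDeriv 1 φ x + partialDeriv 0 ψ x ≠ 0 := by
    intro x hx h
    refine hρ (x, fun _ => 1) ⟨hx, by simp, by simp⟩ ?_
    rw [hricci _ hx, h, mul_zero, neg_zero]
  have hnec := exists_constant_of_locally_metrizable hMo hMc hφ hψ hne
  have hnec' : IsConicMetrizable (positiveCone M) (affineSpray φ ψ) →
      ∃ c : ℝ, c ≠ 0 ∧ c ≠ 1 ∧
        ∀ x ∈ M, c * partialDeriv 1 φ x = (1 - c) * partialDeriv 0 ψ x := fun h =>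
    hnec fun x hx => ⟨M, hMo, hx, Subset.rfl, h⟩
  refine ⟨⟨hnec, ?_⟩, hnec', fun hsc => ⟨hnec', ?_⟩⟩
  · rintro ⟨c, hc0, hc1, hc⟩ x hx
    obtain ⟨r, hr, hrM⟩ := Metric.isOpen_iff.1 hMo x hx
    exact ⟨Metric.ball x r, Metric.isOpen_ball, Metric.mem_ball_self hr, hrM,
      isConicMetrizable_of_primitives Metric.isOpen_ball (hφ.mono hrM) (hψ.mono hrM) hc0 hc1
        (fun y hy => hc y (hrM hy)) fun η hη hdη =>
          (convex_ball x r).exists_forall_hasFDerivAt_of_fderiv_symmetric Metric.isOpen_ball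
            hη hdη⟩
  · rintro ⟨c, hc0, hc1, hc⟩
    exact isConicMetrizable_of_primitives hMo hφ hψ hc0 hc1 hc fun η hη hdη =>
      hsc.exists_forall_hasFDerivAt_of_fderiv_symmetric hMo hη hdη
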